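/- For a finite point set $\mathcal{P}\subset[0,1)^2$ with $N\ge 1$ elements and $\alpha,\beta\in(0,1]$ let $\Delta(\alpha,\beta,\mathcal{P})=\#\bigl(\mathcal{P}\cap([0,\alpha)\times[0,\beta))\bigr)-N\alpha\beta$, and let $$L_2(\mathcal{P})=\frac1N\left(\int_0^1\int_0^1|\Delta(\alpha,\beta,\mathcal{P})|^2\,\mathrm{d}\alpha\,\mathrm{d}\beta\right)^{1/2}$$ be its $L_2$ discrepancy. For a positive integer $m$ and $\sigma=(\sigma_1,\dots,\sigma_m)\in\{0,1\}^m$ let $$\mathcal{H}_m(\sigma)=\left\{\left(\frac{t_m}{2}+\frac{t_{m-1}}{2^2}+\dots+\frac{t_1}{2^m},\ \frac{s_1}{2}+\frac{s_2}{2^2}+\dots+\frac{s_m}{2^m}\right): t_1,\dots,t_m\in\{0,1\}\right\},\qquad s_j=t_j\oplus\sigma_j,$$ where $\oplus$ is addition modulo $2$. Let $\sigma^*=(\sigma_1\oplus1,\dots,\sigma_m\oplus1)$ and $\mathcal{H}_m^{\rm sym}(\sigma)=\mathcal{H}_m(\sigma)\cup\mathcal{H}_m(\sigma^*)$. Theorem.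 Let $m\ge1$ be an integer and $\sigma\in\{0,1\}^m$. Then $\mathcal{H}_m^{\rm sym}(\sigma)$ has exactly $2^{m+1}$ elements, and $$\bigl(2^{m+1}L_2(\mathcal{H}_m^{\rm sym}(\sigma))\bigr)^2=\frac{m}{24}+\frac{11}{8}+\frac{1}{2^m}-\frac{1}{9\cdot2^{2m+1}}.$$ In terms of the number of elements $N=2^{m+1}$ this reads $$L_2(\mathcal{H}_m^{\rm sym}(\sigma))=\frac1N\left(\frac{\log N}{24\log2}+\frac43+\frac2N-\frac{2}{9N^2}\right)^{1/2},$$ where $\log$ is the natural logarithm. In particular, $L_2(\mathcal{H}_m^{\rm sym}(\sigma))=L_2(\mathcal{H}_m^{\rm sym}(\tau))$ for all $\sigma,\tau\in\{0,1\}^m$. -/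

import Mathlib

namespace Hammersley

/-- The number of points of the finite point set `P` in the box `[0,α) × [0,β)`. -/
noncomputable def countBox (α β : ℝ) (P : Finset (ℝ × ℝ)) : ℕ :=
  (P.filter fun x => x ∈ Set.Ico (0 : ℝ) α ×ˢ Set.Ico (0 : ℝ) β).card

/-- The local discrepancy `A([0,α) × [0,β), P) - N α β` of an `N`-element point set `P`. -/
noncomputable def localDiscrepancy (α β : ℝ) (P : Finset (ℝ × ℝ)) : ℝ :=
  (countBox α β P : ℝ) - (P.card : ℝ) * α * β

/-- The `L_p` discrepancy of a (nonempty) finite point set, normalized by the number of points,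
for real `p ≥ 1`. -/
noncomputable def lpDiscrepancy (p : ℝ) (P : Finset (ℝ × ℝ)) : ℝ :=
  1 / (P.card : ℝ) *
    (∫ β in (0 : ℝ)..1, ∫ α in (0 : ℝ)..1, |localDiscrepancy α β P| ^ p) ^ (1 / p)

/-- The point with coordinates `t_m/2 + t_{m-1}/2^2 + ⋯ + t_1/2^m` and
`s_1/2 + s_2/2^2 + ⋯ + s_m/2^m`, where `s_j = t_j ⊕ σ_j`. The digits are indexed from zero:
`t_j` is `t i` with `j = i + 1`. -/
noncomputable def point {m : ℕ} (σ t : Fin m → ZMod 2) : ℝ × ℝ :=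
  (∑ i : Fin m, ((t i).val : ℝ) / 2 ^ (m - (i : ℕ)),
   ∑ i : Fin m, ((t i + σ i).val : ℝ) / 2 ^ ((i : ℕ) + 1))

/-- The digit shifted Hammersley point set `H_m(σ)`. -/
noncomputable def pointSet {m : ℕ} (σ : Fin m → ZMod 2) : Finset (ℝ × ℝ) :=
  Finset.univ.image (point σ)

/-- The complementary shift `σ*`, with `σ*_j = σ_j ⊕ 1`. -/
def compl {m : ℕ} (σ : Fin m → ZMod 2) : Fin m → ZMod 2 :=
  fun i => σ i + 1

/-- The symmetrized Hammersley point set `H_m(σ) ∪ H_m(σ*)`. -/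
noncomputable def symPointSet {m : ℕ} (σ : Fin m → ZMod 2) : Finset (ℝ × ℝ) :=
  pointSet σ ∪ pointSet (compl σ)

end Hammersley

namespace Hammersley

open Finset

/-! Warnock's formula turns the squared `L_2` norm into finite sums over points and pairs of points.
Measured from the common centre c = (1 - 2^(-m))/2, a point is (X, Y) = (`centX t`, `centY σ t`).
Passing to σ* sends Y to -Y, and complementing all digits of t sends (X, Y) to (-X, -Y), so every
odd term drops out.

The remaining sums are computed by induction on m, appending one digit. It becomes the leading digit
of X and the last digit of Y: X is halved and moved by 1/4, while Y moves by 2^(-m-2). Differences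
of Y are separated enough that this move never reverses a nonzero sign, so absolute values stay
linear and the recursions close.

The shift survives only through W = `shiftWeight σ`, in `sum_abs_centX_sub_mul_abs_centY_sub` and
`sum_centX_sq_mul_centY_sq`. With Warnock's weights both terms equal (W^2 - m)/16, with opposite
signs, and cancel. The terms m/6 and -m/12 of the two pair sums, each halved, leave m/24. -/

/-! ### Centred coordinates and their symmetries -/

/-- The digit `a ∈ {0, 1}` written as a sign, `0 ↦ -1` and `1 ↦ 1`. -/
noncomputable def digitSign (a : ZMod 2) : ℝ := 2 * (a.val : ℝ) - 1

@[simp] lemma digitSign_zero : digitSign 0 = -1 := by simp [digitSign]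

@[simp] lemma digitSign_one : digitSign 1 = 1 := by
  have : (1 : ZMod 2).val = 1 := rfl
  norm_num [digitSign, this]

lemma zmod_two_cases (a : ZMod 2) : a = 0 ∨ a = 1 := by
  revert a; decide

lemma digitSign_add (a b : ZMod 2) : digitSign (a + b) = digitSign a * -digitSign b := by
  have : (1 + 1 : ZMod 2) = 0 := rfl
  rcases zmod_two_cases a with rfl | rfl <;> rcases zmod_two_cases b with rfl | rfl <;>
    simp [this]

lemma digitSign_eq_or (a : ZMod 2) : digitSign a = -1 ∨ digitSign a = 1 := by
  rcases zmod_two_cases a with rfl | rfl <;> simp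

/-- First coordinate of a point, measured from the centre of symmetry of the point set. -/
noncomputable def centX {m : ℕ} (t : Fin m → ZMod 2) : ℝ :=
  ∑ i : Fin m, digitSign (t i) / 2 ^ (m - (i : ℕ) + 1)

/-- Second coordinate of a point, measured from the centre of symmetry of the point set. -/
noncomputable def centY {m : ℕ} (σ t : Fin m → ZMod 2) : ℝ :=
  ∑ i : Fin m, digitSign (t i + σ i) / 2 ^ ((i : ℕ) + 2)

/-- Signed count of the digits of the shift. -/
noncomputable def shiftWeight {m : ℕ} (σ : Fin m → ZMod 2) : ℝ :=
  ∑ i : Fin m, -digitSign (σ i)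

lemma centX_snoc {m : ℕ} (t : Fin m → ZMod 2) (a : ZMod 2) :
    centX (Fin.snoc t a : Fin (m + 1) → ZMod 2) = centX t / 2 + digitSign a / 4 := by
  unfold centX
  rw [Fin.sum_univ_castSucc, Finset.sum_div]
  congr 1
  · refine Finset.sum_congr rfl fun i _ => ?_
    have : m + 1 - (i : ℕ) = m - i + 1 := by omega
    simp only [Fin.snoc_castSucc, Fin.val_castSucc, this]
    rw [div_div, ← pow_succ]
  · simp [Fin.snoc_last]; norm_num

lemma centY_snoc {m : ℕ} (σ : Fin (m + 1) → ZMod 2) (t : Fin m → ZMod 2) (a : ZMod 2) :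
    centY σ (Fin.snoc t a : Fin (m + 1) → ZMod 2) =
      centY (Fin.init σ) t + digitSign a * -digitSign (σ (Fin.last m)) / 2 ^ (m + 2) := by
  unfold centY
  rw [Fin.sum_univ_castSucc]
  simp [Fin.snoc_castSucc, Fin.snoc_last, Fin.init, digitSign_add]

lemma shiftWeight_init {m : ℕ} (σ : Fin (m + 1) → ZMod 2) :
    shiftWeight σ = shiftWeight (Fin.init σ) + -digitSign (σ (Fin.last m)) := by
  unfold shiftWeight
  rw [Fin.sum_univ_castSucc]
  simp [Fin.init]

lemma sum_snoc {m : ℕ} (f : (Fin (m + 1) → ZMod 2) → ℝ) :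
    ∑ t, f t = ∑ t : Fin m → ZMod 2, (f (Fin.snoc t 0) + f (Fin.snoc t 1)) := by
  rw [← (Fin.snocEquiv (fun _ : Fin (m + 1) => ZMod 2)).sum_comp, Fintype.sum_prod_type_right]
  refine Finset.sum_congr rfl fun t _ => ?_
  exact Fin.sum_univ_two (fun a : ZMod 2 => f (Fin.snoc t a))

lemma sum_sum_snoc {m : ℕ} (f : (Fin (m + 1) → ZMod 2) → (Fin (m + 1) → ZMod 2) → ℝ) :
    ∑ t, ∑ t', f t t' = ∑ t : Fin m → ZMod 2, ∑ t' : Fin m → ZMod 2,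
      (f (Fin.snoc t 0) (Fin.snoc t' 0) + f (Fin.snoc t 0) (Fin.snoc t' 1) +
        f (Fin.snoc t 1) (Fin.snoc t' 0) + f (Fin.snoc t 1) (Fin.snoc t' 1)) := by
  rw [sum_snoc]
  refine Finset.sum_congr rfl fun t _ => ?_
  rw [sum_snoc, sum_snoc, ← Finset.sum_add_distrib]
  refine Finset.sum_congr rfl fun t' _ => ?_
  ring

lemma centX_compl {m : ℕ} (t : Fin m → ZMod 2) : centX (compl t) = -centX t := by
  unfold centX compl
  rw [← Finset.sum_neg_distrib]
  refine Finset.sum_congr rfl fun i _ => ?_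
  rw [digitSign_add, digitSign_one]; ring

lemma centY_compl {m : ℕ} (σ t : Fin m → ZMod 2) : centY σ (compl t) = -centY σ t := by
  unfold centY compl
  rw [← Finset.sum_neg_distrib]
  refine Finset.sum_congr rfl fun i _ => ?_
  rw [digitSign_add, digitSign_add, digitSign_add, digitSign_one]; ring

lemma centY_compl_shift {m : ℕ} (σ t : Fin m → ZMod 2) :
    centY (compl σ) t = -centY σ t := by
  unfold centY compl
  rw [← Finset.sum_neg_distrib]
  refine Finset.sum_congr rfl fun i _ => ?_
  rw [digitSign_add, digitSign_add, digitSign_add, digitSign_one]; ring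

lemma compl_compl {m : ℕ} (t : Fin m → ZMod 2) : compl (compl t) = t := by
  have : (1 + 1 : ZMod 2) = 0 := rfl
  funext i
  simp [compl, add_assoc, this]

/-- Complementation of all digits, as a permutation. -/
def complEquiv (m : ℕ) : Equiv.Perm (Fin m → ZMod 2) :=
  ⟨compl, compl, compl_compl, compl_compl⟩

lemma sum_compl {m : ℕ} (f : (Fin m → ZMod 2) → ℝ) : ∑ t, f (compl t) = ∑ t, f t :=
  Equiv.sum_comp (complEquiv m) f

/-! ### Range and separation of the coordinates -/

lemma abs_centX_le {m : ℕ} (t : Fin m → ZMod 2) : |centX t| ≤ (1 - 1 / 2 ^ m) / 2 := by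
  induction m with
  | zero => simp [centX]
  | succ m ih =>
    rw [← Fin.snoc_init_self t, centX_snoc]
    have h := abs_le.1 (ih (Fin.init t))
    have hp : (1 : ℝ) / 2 ^ (m + 1) = 1 / 2 ^ m / 2 := by rw [pow_succ, div_div]
    rw [hp, abs_le]
    rcases digitSign_eq_or (t (Fin.last m)) with e | e <;> rw [e] <;> constructor <;> linarith [h.1, h.2]

lemma abs_centX_sub_le {m : ℕ} (t t' : Fin m → ZMod 2) :
    |centX t - centX t'| ≤ 1 - 1 / 2 ^ m := by
  have h := abs_le.1 (abs_centX_le t)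
  have h' := abs_le.1 (abs_centX_le t')
  rw [abs_le]; constructor <;> linarith [h.1, h.2, h'.1, h'.2]

lemma snoc_ne_cases {m : ℕ} {t t' : Fin (m + 1) → ZMod 2} (h : t ≠ t') :
    t (Fin.last m) ≠ t' (Fin.last m) ∨
      (t (Fin.last m) = t' (Fin.last m) ∧ Fin.init t ≠ Fin.init t') := by
  by_cases hl : t (Fin.last m) = t' (Fin.last m)
  · refine Or.inr ⟨hl, fun hi => h ?_⟩
    rw [← Fin.snoc_init_self t, ← Fin.snoc_init_self t', hl, hi]
  · exact Or.inl hl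

lemma digitSign_of_ne {a b : ZMod 2} (h : a ≠ b) :
    (digitSign a = -1 ∧ digitSign b = 1) ∨ (digitSign a = 1 ∧ digitSign b = -1) := by
  rcases zmod_two_cases a with rfl | rfl <;> rcases zmod_two_cases b with rfl | rfl <;>
    simp at h ⊢

lemma le_abs_centX_sub {m : ℕ} {t t' : Fin m → ZMod 2} (h : t ≠ t') :
    1 / 2 ^ m ≤ |centX t - centX t'| := by
  induction m with
  | zero => exact absurd (Subsingleton.elim t t') h
  | succ m ih =>
    have hp : (1 : ℝ) / 2 ^ (m + 1) = 1 / 2 ^ m / 2 := by rw [pow_succ, div_div]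
    have hb := abs_le.1 (abs_centX_sub_le (Fin.init t) (Fin.init t'))
    have e1 := centX_snoc (Fin.init t) (t (Fin.last m))
    have e2 := centX_snoc (Fin.init t') (t' (Fin.last m))
    rw [Fin.snoc_init_self] at e1 e2
    rw [e1, e2, hp]
    rcases snoc_ne_cases h with hl | ⟨hl, hi⟩
    · rcases digitSign_of_ne hl with ⟨h1, h2⟩ | ⟨h1, h2⟩ <;> rw [h1, h2, le_abs]
      · right; linarith [hb.1, hb.2]
      · left; linarith [hb.1, hb.2]
    · rw [hl]
      have := ih hi
      rw [le_abs] at this ⊢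
      rcases this with h | h
      · left; linarith
      · right; linarith

/-- If the earlier digits differ, the induction gives a gap of 2^(-m), and the last digit changes it
by at most half of that. If they agree, the last digit alone gives 2^(-m-1). -/
lemma le_abs_centY_sub {m : ℕ} (σ : Fin m → ZMod 2) {t t' : Fin m → ZMod 2} (h : t ≠ t') :
    1 / 2 ^ m ≤ |centY σ t - centY σ t'| := by
  induction m with
  | zero => exact absurd (Subsingleton.elim t t') h
  | succ m ih =>
    have hp : (1 : ℝ) / 2 ^ (m + 1) = 1 / 2 ^ m / 2 := by rw [pow_succ, div_div]
    have hp2 : (2 : ℝ) ^ (m + 2) = 2 ^ m * 4 := by rw [pow_add]; norm_num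
    have hpos : (0 : ℝ) < 1 / 2 ^ m := by positivity
    have e1 := centY_snoc σ (Fin.init t) (t (Fin.last m))
    have e2 := centY_snoc σ (Fin.init t') (t' (Fin.last m))
    rw [Fin.snoc_init_self, hp2, ← div_div, div_eq_mul_one_div _ ((2 : ℝ) ^ m)] at e1 e2
    rw [e1, e2, hp]
    generalize (1 : ℝ) / 2 ^ m = h at *
    rcases digitSign_eq_or (σ (Fin.last m)) with hs | hs <;> rw [hs]
    all_goals
      rcases snoc_ne_cases ‹t ≠ t'› with hl | ⟨hl, hi⟩
      · by_cases hi : Fin.init t = Fin.init t'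
        · rcases digitSign_of_ne hl with ⟨h1, h2⟩ | ⟨h1, h2⟩ <;> rw [h1, h2, hi, le_abs] <;>
            first | (left; linarith) | (right; linarith)
        · have := ih (Fin.init σ) hi
          rcases digitSign_of_ne hl with ⟨h1, h2⟩ | ⟨h1, h2⟩ <;> rw [h1, h2] <;>
            rw [le_abs] at this ⊢ <;> rcases this with h | h <;>
            first | (left; linarith) | (right; linarith)
      · rw [hl]
        have := ih (Fin.init σ) hi
        rw [le_abs] at this ⊢
        rcases this with h | h
        · left; linarith
        · right; linarith

lemma abs_add_eq_of_abs_le {d h : ℝ} (hd : d ≠ 0) (hh : |h| ≤ |d|) :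
    |d + h| = |d| + h * Real.sign d := by
  have := abs_le.1 hh
  rcases lt_or_gt_of_ne hd with hd | hd
  · rw [Real.sign_of_neg hd, abs_of_neg hd, abs_of_nonpos]
    · ring
    · rw [abs_of_neg hd] at this; linarith [this.2]
  · rw [Real.sign_of_pos hd, abs_of_pos hd, abs_of_nonneg]
    · ring
    · rw [abs_of_pos hd] at this; linarith [this.1]

lemma sign_add_eq_of_abs_lt {d h : ℝ} (hh : |h| < |d|) :
    Real.sign (d + h) = Real.sign d := by
  have := abs_lt.1 hh
  have hd : d ≠ 0 := by rintro rfl; simp at hh; exact absurd hh (not_lt.2 (abs_nonneg _))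
  rcases lt_or_gt_of_ne hd with hd | hd
  · rw [abs_of_neg hd] at this
    rw [Real.sign_of_neg hd, Real.sign_of_neg (by linarith [this.2])]
  · rw [abs_of_pos hd] at this
    rw [Real.sign_of_pos hd, Real.sign_of_pos (by linarith [this.1])]

/-! ### Moments of a single point -/

lemma sum_const_digits (m : ℕ) (c : ℝ) : ∑ _t : Fin m → ZMod 2, c = 2 ^ m * c := by
  rw [Finset.sum_const, Finset.card_univ, Fintype.card_fun, ZMod.card, Fintype.card_fin,
    nsmul_eq_mul]
  push_cast; ring

lemma neg_digitSign_sq (a : ZMod 2) : (-digitSign a) ^ 2 = 1 := by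
  rcases digitSign_eq_or a with h | h <;> rw [h] <;> norm_num

lemma abs_neg_digitSign (a : ZMod 2) : |-digitSign a| = 1 := by
  rcases digitSign_eq_or a with h | h <;> rw [h] <;> norm_num

lemma sum_centX_sq (m : ℕ) :
    ∑ t : Fin m → ZMod 2, centX t ^ 2 = (2 ^ m - 1 / 2 ^ m) / 12 := by
  induction m with
  | zero => simp [centX]
  | succ m ih =>
    have hM : (2 : ℝ) ^ m ≠ 0 := by positivity
    rw [sum_snoc]
    calc _ = ∑ t : Fin m → ZMod 2, (centX t ^ 2 * (1 / 2) + 1 / 8) := by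
          refine Finset.sum_congr rfl fun t _ => ?_
          rw [centX_snoc, centX_snoc, digitSign_zero, digitSign_one]; ring
      _ = _ := by
          rw [Finset.sum_add_distrib, ← Finset.sum_mul, ih, sum_const_digits, pow_succ]
          field_simp; ring

lemma sum_centY_sq {m : ℕ} (σ : Fin m → ZMod 2) :
    ∑ t : Fin m → ZMod 2, centY σ t ^ 2 = (2 ^ m - 1 / 2 ^ m) / 12 := by
  induction m with
  | zero => simp [centY]
  | succ m ih =>
    have hM : (2 : ℝ) ^ m ≠ 0 := by positivity
    have he := neg_digitSign_sq (σ (Fin.last m))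
    rw [sum_snoc]
    calc _ = ∑ t : Fin m → ZMod 2, (centY (Fin.init σ) t ^ 2 * 2 + 2 * (1 / 2 ^ (m + 2)) ^ 2) := by
          refine Finset.sum_congr rfl fun t _ => ?_
          rw [centY_snoc, centY_snoc, digitSign_zero, digitSign_one]
          linear_combination 2 * (1 / 2 ^ (m + 2)) ^ 2 * he
      _ = _ := by
          rw [Finset.sum_add_distrib, ← Finset.sum_mul, ih, sum_const_digits, pow_succ, pow_add]
          field_simp; ring

lemma sum_centX_mul_centY {m : ℕ} (σ : Fin m → ZMod 2) :
    ∑ t : Fin m → ZMod 2, centX t * centY σ t = shiftWeight σ / 8 := by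
  induction m with
  | zero => simp [centX, shiftWeight]
  | succ m ih =>
    have hM : (2 : ℝ) ^ m ≠ 0 := by positivity
    rw [sum_snoc, shiftWeight_init]
    generalize hε : -digitSign (σ (Fin.last m)) = ε
    calc _ = ∑ t : Fin m → ZMod 2,
            (centX t * centY (Fin.init σ) t + ε / (2 * 2 ^ (m + 2))) := by
          refine Finset.sum_congr rfl fun t _ => ?_
          rw [centY_snoc, centY_snoc, centX_snoc, centX_snoc, digitSign_zero, digitSign_one, hε]
          field_simp; ring
      _ = _ := by
          rw [Finset.sum_add_distrib, ih, sum_const_digits, pow_add]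
          field_simp; ring

/-- Terms odd in the new digit cancel. The correlation of X and Y enters with factor ε and supplies
the cross term 2Wε of (W + ε)^2; since ε^2 = 1, the quantity W^2 - m grows by exactly that. -/
lemma sum_centX_sq_mul_centY_sq {m : ℕ} (σ : Fin m → ZMod 2) :
    ∑ t : Fin m → ZMod 2, centX t ^ 2 * centY σ t ^ 2 =
      2 ^ m / 144 - 1 / (72 * 2 ^ m) + 1 / (144 * (2 ^ m) ^ 3) +
        (shiftWeight σ ^ 2 - m) / (32 * 2 ^ m) := by
  induction m with
  | zero => norm_num [centX, shiftWeight]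
  | succ m ih =>
    have hM : (2 : ℝ) ^ m ≠ 0 := by positivity
    have he := neg_digitSign_sq (σ (Fin.last m))
    rw [sum_snoc, shiftWeight_init]
    generalize hε : -digitSign (σ (Fin.last m)) = ε at *
    calc _ = ∑ t : Fin m → ZMod 2,
            (centX t ^ 2 * centY (Fin.init σ) t ^ 2 * (1 / 2) + centY (Fin.init σ) t ^ 2 * (1 / 8)
              + centX t ^ 2 * ((1 / 2 ^ (m + 2)) ^ 2 / 2) + (1 / 2 ^ (m + 2)) ^ 2 / 8
              + centX t * centY (Fin.init σ) t * (ε * (1 / 2 ^ (m + 2)))) := by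
          refine Finset.sum_congr rfl fun t _ => ?_
          rw [centY_snoc, centY_snoc, centX_snoc, centX_snoc, digitSign_zero, digitSign_one, hε]
          linear_combination (centX t ^ 2 / 2 + 1 / 8) * (1 / 2 ^ (m + 2)) ^ 2 * he
      _ = _ := by
          simp only [Finset.sum_add_distrib, ← Finset.sum_mul]
          rw [ih, sum_const_digits, sum_centX_sq, sum_centY_sq, sum_centX_mul_centY, pow_add,
            pow_add, pow_one, add_sq, he]
          push_cast
          field_simp; ring

/-! ### Pair sums within one Hammersley set -/

lemma abs_sub_half_cases {d : ℝ} (hd : |d| ≤ 1) :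
    |d / 2 + 1 / 2| = (1 + d) / 2 ∧ |d / 2 - 1 / 2| = (1 - d) / 2 := by
  have := abs_le.1 hd
  constructor
  · rw [abs_of_nonneg] <;> linarith [this.1]
  · rw [abs_of_nonpos] <;> linarith [this.2]

lemma abs_centX_sub_le_one {m : ℕ} (t t' : Fin m → ZMod 2) : |centX t - centX t'| ≤ 1 := by
  have : (0 : ℝ) < 1 / 2 ^ m := by positivity
  linarith [abs_centX_sub_le t t']

/-- The four absolute differences of first coordinates obtained by appending a digit. -/
lemma abs_centX_snoc_sub {m : ℕ} (t t' : Fin m → ZMod 2) (a : ZMod 2) :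
    |centX (Fin.snoc t a : Fin (m + 1) → ZMod 2) - centX (Fin.snoc t' a : Fin (m + 1) → ZMod 2)| =
      |centX t - centX t'| / 2 ∧
    |centX (Fin.snoc t 0 : Fin (m + 1) → ZMod 2) - centX (Fin.snoc t' 1 : Fin (m + 1) → ZMod 2)| =
      (1 - (centX t - centX t')) / 2 ∧
    |centX (Fin.snoc t 1 : Fin (m + 1) → ZMod 2) - centX (Fin.snoc t' 0 : Fin (m + 1) → ZMod 2)| =
      (1 + (centX t - centX t')) / 2 := by
  obtain ⟨h1, h2⟩ := abs_sub_half_cases (abs_centX_sub_le_one t t')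
  simp only [centX_snoc, digitSign_zero, digitSign_one]
  refine ⟨?_, ?_, ?_⟩
  · rw [show (2 : ℝ) = |2| by norm_num, ← abs_div]; congr 1; norm_num; ring
  · rw [← h2]; congr 1; ring
  · rw [← h1]; congr 1; ring

lemma sum_abs_centX_sub (m : ℕ) :
    ∑ t : Fin m → ZMod 2, ∑ t' : Fin m → ZMod 2, |centX t - centX t'| =
      ((2 ^ m) ^ 2 - 1) / 3 := by
  induction m with
  | zero => simp [centX]
  | succ m ih =>
    rw [sum_sum_snoc]
    calc _ = ∑ t : Fin m → ZMod 2, ∑ t' : Fin m → ZMod 2, (|centX t - centX t'| + 1) := by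
          refine Finset.sum_congr rfl fun t _ => Finset.sum_congr rfl fun t' _ => ?_
          rw [(abs_centX_snoc_sub t t' 0).1, (abs_centX_snoc_sub t t' 1).1,
            (abs_centX_snoc_sub t t' 0).2.1, (abs_centX_snoc_sub t t' 0).2.2]
          ring
      _ = _ := by
          simp only [Finset.sum_add_distrib, sum_const_digits]
          rw [ih]; ring

/-- Differences of second coordinates after appending different digits. -/
lemma abs_centY_snoc_sub {m : ℕ} (σ t t' : Fin m → ZMod 2) {ε : ℝ} (hε : |ε| = 1) :
    |centY σ t - centY σ t' + ε / 2 ^ (m + 1)| =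
      |centY σ t - centY σ t'| + ε / 2 ^ (m + 1) * Real.sign (centY σ t - centY σ t') +
        if t = t' then 1 / 2 ^ (m + 1) else 0 := by
  have hp : (0 : ℝ) < 2 ^ m := by positivity
  have he : |ε / 2 ^ (m + 1)| = 1 / 2 ^ (m + 1) := by
    rw [abs_div, hε, abs_of_pos (by positivity)]
  by_cases h : t = t'
  · subst h; simp [he, -one_div]
  · have := le_abs_centY_sub σ h
    have hlt : (1 : ℝ) / 2 ^ (m + 1) < 1 / 2 ^ m := by
      rw [pow_succ]; gcongr; linarith
    rw [abs_add_eq_of_abs_le, if_neg h, add_zero]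
    · intro h0; rw [h0, abs_zero] at this
      exact absurd this (not_le.2 (by positivity))
    · rw [he]; linarith

/-- The perturbation is half the minimal gap, so it matters only on the diagonal, where a zero
difference acquires the sign ε. -/
lemma sign_centY_snoc_sub {m : ℕ} (σ t t' : Fin m → ZMod 2) {ε : ℝ} (hε : ε = -1 ∨ ε = 1) :
    Real.sign (centY σ t - centY σ t' + ε / 2 ^ (m + 1)) =
      Real.sign (centY σ t - centY σ t') + if t = t' then ε else 0 := by
  by_cases h : t = t'
  · subst h
    have hp : (0 : ℝ) < 1 / 2 ^ (m + 1) := by positivity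
    rcases hε with rfl | rfl
    · rw [Real.sign_of_neg (by rw [neg_div, sub_self, zero_add]; linarith)]; simp
    · rw [Real.sign_of_pos (by rw [sub_self, zero_add]; exact hp)]; simp
  · have := le_abs_centY_sub σ h
    have he : |ε| = 1 := by rcases hε with rfl | rfl <;> simp
    rw [sign_add_eq_of_abs_lt, if_neg h, add_zero]
    refine lt_of_lt_of_le ?_ this
    rw [abs_div, he, abs_of_pos (by positivity), pow_succ]
    gcongr
    have hp : (0 : ℝ) < 2 ^ m := by positivity
    linarith

lemma centY_snoc_sub {m : ℕ} (σ : Fin (m + 1) → ZMod 2) (t t' : Fin m → ZMod 2) (a : ZMod 2) :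
    centY σ (Fin.snoc t a : Fin (m + 1) → ZMod 2) - centY σ (Fin.snoc t' a : Fin (m + 1) → ZMod 2) =
      centY (Fin.init σ) t - centY (Fin.init σ) t' ∧
    centY σ (Fin.snoc t 0 : Fin (m + 1) → ZMod 2) - centY σ (Fin.snoc t' 1 : Fin (m + 1) → ZMod 2) =
      centY (Fin.init σ) t - centY (Fin.init σ) t'
        + digitSign (σ (Fin.last m)) / 2 ^ (m + 1) ∧
    centY σ (Fin.snoc t 1 : Fin (m + 1) → ZMod 2) - centY σ (Fin.snoc t' 0 : Fin (m + 1) → ZMod 2) =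
      centY (Fin.init σ) t - centY (Fin.init σ) t'
        + -digitSign (σ (Fin.last m)) / 2 ^ (m + 1) := by
  simp only [centY_snoc, digitSign_zero, digitSign_one]
  refine ⟨by ring, ?_, ?_⟩ <;> · field_simp; ring

lemma abs_digitSign (a : ZMod 2) : |digitSign a| = 1 := by
  rw [← abs_neg]; exact abs_neg_digitSign a

lemma sum_sum_ite (m : ℕ) (c : ℝ) :
    ∑ t : Fin m → ZMod 2, ∑ t' : Fin m → ZMod 2, (if t = t' then c else 0) = 2 ^ m * c := by
  simp only [Finset.sum_ite_eq, Finset.mem_univ, if_true]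
  exact sum_const_digits m c

lemma sum_abs_centY_sub {m : ℕ} (σ : Fin m → ZMod 2) :
    ∑ t : Fin m → ZMod 2, ∑ t' : Fin m → ZMod 2, |centY σ t - centY σ t'| =
      ((2 ^ m) ^ 2 - 1) / 3 := by
  induction m with
  | zero => simp [centY]
  | succ m ih =>
    have hM : (2 : ℝ) ^ m ≠ 0 := by positivity
    rw [sum_sum_snoc]
    calc _ = ∑ t : Fin m → ZMod 2, ∑ t' : Fin m → ZMod 2,
          (|centY (Fin.init σ) t - centY (Fin.init σ) t'| * 4 +
            (if t = t' then 1 / 2 ^ (m + 1) else 0) * 2) := by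
          refine Finset.sum_congr rfl fun t _ => Finset.sum_congr rfl fun t' _ => ?_
          rw [(centY_snoc_sub σ t t' 0).1, (centY_snoc_sub σ t t' 1).1,
            (centY_snoc_sub σ t t' 0).2.1, (centY_snoc_sub σ t t' 0).2.2,
            abs_centY_snoc_sub _ _ _ (abs_digitSign _),
            abs_centY_snoc_sub _ _ _ (abs_neg_digitSign _)]
          ring
      _ = _ := by
          simp only [Finset.sum_add_distrib, ← Finset.sum_mul]
          rw [ih, sum_sum_ite, pow_succ]; field_simp; ring

/-- This is the first-order term in the recursion for the product of absolute differences. Off the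
diagonal the leading-digit offsets ±1/2 cancel between the two mixed digit pairs; on it they add up
to ε. -/
lemma sum_centX_sub_mul_sign {m : ℕ} (σ : Fin m → ZMod 2) :
    ∑ t : Fin m → ZMod 2, ∑ t' : Fin m → ZMod 2,
      (centX t - centX t') * Real.sign (centY σ t - centY σ t') =
      2 ^ m * shiftWeight σ / 2 := by
  induction m with
  | zero => simp [centX, shiftWeight]
  | succ m ih =>
    rw [sum_sum_snoc, shiftWeight_init]
    calc _ = ∑ t : Fin m → ZMod 2, ∑ t' : Fin m → ZMod 2,
          ((centX t - centX t') * Real.sign (centY (Fin.init σ) t - centY (Fin.init σ) t') * 2 +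
            (if t = t' then -digitSign (σ (Fin.last m)) else 0)) := by
          refine Finset.sum_congr rfl fun t _ => Finset.sum_congr rfl fun t' _ => ?_
          rw [(centY_snoc_sub σ t t' 0).1, (centY_snoc_sub σ t t' 1).1,
            (centY_snoc_sub σ t t' 0).2.1, (centY_snoc_sub σ t t' 0).2.2,
            sign_centY_snoc_sub _ _ _ (digitSign_eq_or _),
            sign_centY_snoc_sub _ _ _ (by
              rcases digitSign_eq_or (σ (Fin.last m)) with h | h <;> rw [h] <;> norm_num)]
          simp only [centX_snoc, digitSign_zero, digitSign_one]
          split_ifs <;> ring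
      _ = _ := by
          simp only [Finset.sum_add_distrib, ← Finset.sum_mul]
          rw [ih, sum_sum_ite, pow_succ]; ring

lemma sum_abs_centX_sub_mul_abs_centY_sub {m : ℕ} (σ : Fin m → ZMod 2) :
    ∑ t : Fin m → ZMod 2, ∑ t' : Fin m → ZMod 2,
      |centX t - centX t'| * |centY σ t - centY σ t'| =
      ((2 ^ m) ^ 2 - 1) / 9 + m / 6 + (shiftWeight σ ^ 2 - m) / 8 := by
  induction m with
  | zero => simp [centX, shiftWeight]
  | succ m ih =>
    have hM : (2 : ℝ) ^ m ≠ 0 := by positivity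
    have he := neg_digitSign_sq (σ (Fin.last m))
    rw [sum_sum_snoc, shiftWeight_init]
    calc _ = ∑ t : Fin m → ZMod 2, ∑ t' : Fin m → ZMod 2,
          (|centX t - centX t'| * |centY (Fin.init σ) t - centY (Fin.init σ) t'| +
            |centY (Fin.init σ) t - centY (Fin.init σ) t'| +
            (if t = t' then 1 / 2 ^ (m + 1) else 0) +
            (centX t - centX t') * Real.sign (centY (Fin.init σ) t - centY (Fin.init σ) t') *
              (-digitSign (σ (Fin.last m)) / 2 ^ (m + 1))) := by
          refine Finset.sum_congr rfl fun t _ => Finset.sum_congr rfl fun t' _ => ?_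
          rw [(centY_snoc_sub σ t t' 0).1, (centY_snoc_sub σ t t' 1).1,
            (centY_snoc_sub σ t t' 0).2.1, (centY_snoc_sub σ t t' 0).2.2,
            abs_centY_snoc_sub _ _ _ (abs_digitSign _),
            abs_centY_snoc_sub _ _ _ (abs_neg_digitSign _),
            (abs_centX_snoc_sub t t' 0).1, (abs_centX_snoc_sub t t' 1).1,
            (abs_centX_snoc_sub t t' 0).2.1, (abs_centX_snoc_sub t t' 0).2.2]
          ring
      _ = _ := by
          simp only [Finset.sum_add_distrib, ← Finset.sum_mul]
          rw [ih, sum_sum_ite, sum_abs_centY_sub, sum_centX_sub_mul_sign, pow_succ, add_sq, he]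
          push_cast
          field_simp; ring

/-! ### Pair sums between the set and its reflection -/

/-- The leading digit decides the sign of X. With no digits X = 0 and the formula fails, hence the
index m + 1. -/
lemma sum_abs_centX_succ (m : ℕ) :
    ∑ t : Fin (m + 1) → ZMod 2, |centX t| = 2 ^ (m + 1) / 4 := by
  rw [sum_snoc]
  calc _ = ∑ t : Fin m → ZMod 2, (1 / 2 : ℝ) := by
        refine Finset.sum_congr rfl fun t _ => ?_
        have h0 : (0 : ℝ) < 1 / 2 ^ m := by positivity
        have := abs_le.1 (abs_centX_le t)
        rw [centX_snoc, centX_snoc, digitSign_zero, digitSign_one, abs_of_nonpos, abs_of_nonneg]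
        · ring
        · linarith [this.1]
        · linarith [this.2]
    _ = _ := by rw [sum_const_digits]; ring

lemma abs_centY_add_add_abs_sub {m : ℕ} (σ t t' : Fin m → ZMod 2) {ε : ℝ} (hε : |ε| = 1) :
    |centY σ t + centY σ t' + ε / 2 ^ (m + 1)| + |centY σ t + centY σ t' - ε / 2 ^ (m + 1)| =
      2 * |centY σ t + centY σ t'| + if t = compl t' then 2 / 2 ^ (m + 1) else 0 := by
  have h1 := abs_centY_snoc_sub σ t (compl t') hε
  have h2 := abs_centY_snoc_sub σ t (compl t') (ε := -ε) (by rw [abs_neg, hε])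
  rw [centY_compl, sub_neg_eq_add] at h1 h2
  rw [neg_div, ← sub_eq_add_neg] at h2
  rw [h1, h2]
  split_ifs <;> ring

/-- Here the moves of Y cancel for mixed digits, and for equal digits they occur with both signs and
the same weight. No ε survives; the only correction comes from t = `compl t'`, where Y + Y'
vanishes. -/
lemma sum_abs_centX_sub_mul_abs_centY_add_snoc {m : ℕ} (σ : Fin (m + 1) → ZMod 2) :
    ∑ t : Fin (m + 1) → ZMod 2, ∑ t' : Fin (m + 1) → ZMod 2,
      |centX t - centX t'| * |centY σ t + centY σ t'| =
    ∑ t : Fin m → ZMod 2, ∑ t' : Fin m → ZMod 2,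
      |centX t - centX t'| * |centY (Fin.init σ) t + centY (Fin.init σ) t'| +
    ((2 ^ m) ^ 2 - 1) / 3 + (∑ t : Fin m → ZMod 2, |centX t|) / 2 ^ m := by
  have hM : (2 : ℝ) ^ m ≠ 0 := by positivity
  rw [sum_sum_snoc]
  calc _ = ∑ t : Fin m → ZMod 2, ∑ t' : Fin m → ZMod 2,
        (|centX t - centX t'| * |centY (Fin.init σ) t + centY (Fin.init σ) t'| +
          |centY (Fin.init σ) t - centY (Fin.init σ) (compl t')| +
          if t = compl t' then |centX t| * (1 / 2 ^ m) else 0) := by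
        refine Finset.sum_congr rfl fun t _ => Finset.sum_congr rfl fun t' _ => ?_
        have h := abs_centY_add_add_abs_sub (Fin.init σ) t t' (abs_neg_digitSign (σ (Fin.last m)))
        rw [(abs_centX_snoc_sub t t' 0).1, (abs_centX_snoc_sub t t' 1).1,
          (abs_centX_snoc_sub t t' 0).2.1, (abs_centX_snoc_sub t t' 0).2.2, centY_compl,
          sub_neg_eq_add]
        simp only [centY_snoc, digitSign_zero, digitSign_one]
        generalize -digitSign (σ (Fin.last m)) = ε at *
        rw [show centY (Fin.init σ) t + -1 * ε / 2 ^ (m + 2) +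
              (centY (Fin.init σ) t' + -1 * ε / 2 ^ (m + 2)) =
              centY (Fin.init σ) t + centY (Fin.init σ) t' - ε / 2 ^ (m + 1) by
            field_simp; ring,
          show centY (Fin.init σ) t + 1 * ε / 2 ^ (m + 2) +
              (centY (Fin.init σ) t' + 1 * ε / 2 ^ (m + 2)) =
              centY (Fin.init σ) t + centY (Fin.init σ) t' + ε / 2 ^ (m + 1) by
            field_simp; ring,
          show centY (Fin.init σ) t + -1 * ε / 2 ^ (m + 2) +
              (centY (Fin.init σ) t' + 1 * ε / 2 ^ (m + 2)) =
              centY (Fin.init σ) t + centY (Fin.init σ) t' by ring,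
          show centY (Fin.init σ) t + 1 * ε / 2 ^ (m + 2) +
              (centY (Fin.init σ) t' + -1 * ε / 2 ^ (m + 2)) =
              centY (Fin.init σ) t + centY (Fin.init σ) t' by ring]
        have hX : (if t = compl t' then |centX t| * (1 / 2 ^ m) else (0 : ℝ)) =
            |centX t - centX t'| / 2 * (if t = compl t' then 2 / 2 ^ (m + 1) else 0) := by
          split_ifs with hc
          · have : centX t - centX t' = 2 * centX t := by rw [hc, centX_compl]; ring
            rw [this, abs_mul, abs_two, pow_succ]
            field_simp
          · ring
        rw [hX]
        linear_combination |centX t - centX t'| / 2 * h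
    _ = _ := by
        simp only [Finset.sum_add_distrib]
        congr 1
        · congr 1
          rw [← sum_abs_centY_sub (Fin.init σ)]
          refine Finset.sum_congr rfl fun t _ => ?_
          exact sum_compl (fun t' => |centY (Fin.init σ) t - centY (Fin.init σ) t'|)
        · rw [Finset.sum_div]
          refine Finset.sum_congr rfl fun t _ => ?_
          rw [sum_compl (fun t' => if t = t' then |centX t| * (1 / 2 ^ m) else 0)]
          simp [div_eq_mul_inv]

lemma sum_abs_centX_sub_mul_abs_centY_add {m : ℕ} (σ : Fin (m + 1) → ZMod 2) :
    ∑ t : Fin (m + 1) → ZMod 2, ∑ t' : Fin (m + 1) → ZMod 2,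
      |centX t - centX t'| * |centY σ t + centY σ t'| =
      ((2 ^ (m + 1)) ^ 2 - 1) / 9 - (m + 1) / 12 - 1 / 4 := by
  induction m with
  | zero =>
    rw [sum_abs_centX_sub_mul_abs_centY_add_snoc]
    norm_num [centX]
  | succ m ih =>
    have hM : (2 : ℝ) ^ m ≠ 0 := by positivity
    rw [sum_abs_centX_sub_mul_abs_centY_add_snoc, ih, sum_abs_centX_succ]
    push_cast
    field_simp; ring

/-! ### Integration and Warnock's formula -/

/-- The indicator of `x < α`, as a function of `α`. -/
noncomputable def step (x α : ℝ) : ℝ := if x < α then 1 else 0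

lemma step_mul_step (x y α : ℝ) : step x α * step y α = step (max x y) α := by
  unfold step
  by_cases h1 : x < α <;> by_cases h2 : y < α <;> simp [h1, h2]

lemma mul_step_eq_indicator (g : ℝ → ℝ) (x : ℝ) :
    (fun α => g α * step x α) = (Set.Ioi x).indicator g := by
  funext α
  simp [step, Set.indicator_apply]

lemma intervalIntegrable_mul_step {g : ℝ → ℝ} (hg : Continuous g) (x : ℝ) :
    IntervalIntegrable (fun α => g α * step x α) MeasureTheory.volume 0 1 := by
  rw [mul_step_eq_indicator, intervalIntegrable_iff]
  exact (intervalIntegrable_iff.1 (hg.intervalIntegrable 0 1)).indicator measurableSet_Ioi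

lemma integral_mul_step (g : ℝ → ℝ) {x : ℝ} (h0 : 0 ≤ x) (h1 : x ≤ 1) :
    ∫ α in (0 : ℝ)..1, g α * step x α = ∫ α in x..1, g α := by
  rw [mul_step_eq_indicator, intervalIntegral.integral_of_le zero_le_one,
    intervalIntegral.integral_of_le h1, MeasureTheory.setIntegral_indicator measurableSet_Ioi]
  congr 2
  ext a
  simp only [Set.mem_inter_iff, Set.mem_Ioc, Set.mem_Ioi]
  constructor
  · rintro ⟨⟨_, h⟩, h'⟩; exact ⟨h', h⟩
  · rintro ⟨h, h'⟩; exact ⟨⟨by linarith, h'⟩, h⟩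

lemma intervalIntegrable_step (x : ℝ) :
    IntervalIntegrable (step x) MeasureTheory.volume 0 1 := by
  simpa using intervalIntegrable_mul_step (g := fun _ => 1) continuous_const x

lemma integral_step {x : ℝ} (h0 : 0 ≤ x) (h1 : x ≤ 1) :
    ∫ α in (0 : ℝ)..1, step x α = 1 - x := by
  simpa using integral_mul_step (fun _ => 1) h0 h1

lemma integral_id_mul_step {x : ℝ} (h0 : 0 ≤ x) (h1 : x ≤ 1) :
    ∫ α in (0 : ℝ)..1, α * step x α = (1 - x ^ 2) / 2 := by
  rw [integral_mul_step (fun α => α) h0 h1, integral_id]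
  ring

lemma countBox_eq_sum {P : Finset (ℝ × ℝ)} (hP : ∀ p ∈ P, 0 ≤ p.1 ∧ 0 ≤ p.2) (α β : ℝ) :
    (countBox α β P : ℝ) = ∑ p ∈ P, step p.1 α * step p.2 β := by
  classical
  unfold countBox
  rw [Finset.card_filter]
  push_cast
  refine Finset.sum_congr rfl fun p hp => ?_
  obtain ⟨h1, h2⟩ := hP p hp
  unfold step
  by_cases h3 : p.1 < α <;> by_cases h4 : p.2 < β <;> simp [Set.mem_prod, h1, h2, h3, h4]

/-- Stated with arbitrary coefficients so that it serves twice: for the integral in α, with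
coefficients depending on β, and then for the integral in β. -/
lemma integral_quadratic_step {ι : Type*} (s : Finset ι) (c : ι → ι → ℝ) (d : ι → ℝ) (e : ℝ)
    {x : ι → ℝ} (hx : ∀ i ∈ s, 0 ≤ x i ∧ x i ≤ 1) :
    ∫ α in (0 : ℝ)..1, (∑ i ∈ s, ∑ j ∈ s, c i j * step (max (x i) (x j)) α -
        ∑ i ∈ s, d i * (α * step (x i) α) + e * α ^ 2) =
      ∑ i ∈ s, ∑ j ∈ s, c i j * (1 - max (x i) (x j)) - ∑ i ∈ s, d i * ((1 - x i ^ 2) / 2)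
        + e / 3 := by
  have i0 : ∀ i ∈ s, ∀ j ∈ s, IntervalIntegrable
      (fun α => c i j * step (max (x i) (x j)) α) MeasureTheory.volume 0 1 :=
    fun i _ j _ => (intervalIntegrable_step _).const_mul _
  have i1 : ∀ i ∈ s, IntervalIntegrable
      (fun α => ∑ j ∈ s, c i j * step (max (x i) (x j)) α) MeasureTheory.volume 0 1 := by
    intro i hi
    simpa only [Finset.sum_fn] using IntervalIntegrable.sum s (i0 i hi)
  have i2 : IntervalIntegrable
      (fun α => ∑ i ∈ s, ∑ j ∈ s, c i j * step (max (x i) (x j)) α)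
      MeasureTheory.volume 0 1 := by
    simpa only [Finset.sum_fn] using IntervalIntegrable.sum s i1
  have i3 : ∀ i ∈ s, IntervalIntegrable
      (fun α => d i * (α * step (x i) α)) MeasureTheory.volume 0 1 :=
    fun i _ => (intervalIntegrable_mul_step continuous_id _).const_mul _
  have i4 : IntervalIntegrable
      (fun α => ∑ i ∈ s, d i * (α * step (x i) α)) MeasureTheory.volume 0 1 := by
    simpa only [Finset.sum_fn] using IntervalIntegrable.sum s i3
  have i5 : IntervalIntegrable (fun α : ℝ => e * α ^ 2) MeasureTheory.volume 0 1 :=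
    (by fun_prop : Continuous fun α : ℝ => e * α ^ 2).intervalIntegrable _ _
  rw [intervalIntegral.integral_add (i2.sub i4) i5, intervalIntegral.integral_sub i2 i4,
    intervalIntegral.integral_finsetSum i1, intervalIntegral.integral_finsetSum i3,
    intervalIntegral.integral_const_mul, integral_pow]
  congr 1
  · congr 1
    · refine Finset.sum_congr rfl fun i hi => ?_
      rw [intervalIntegral.integral_finsetSum (i0 i hi)]
      refine Finset.sum_congr rfl fun j hj => ?_
      rw [intervalIntegral.integral_const_mul, integral_step]
      · exact le_max_of_le_left (hx i hi).1
      · exact max_le (hx i hi).2 (hx j hj).2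
    · refine Finset.sum_congr rfl fun i hi => ?_
      rw [intervalIntegral.integral_const_mul, integral_id_mul_step (hx i hi).1 (hx i hi).2]
  · norm_num; ring

/-- Warnock's formula for the squared `L_2` norm of the local discrepancy. -/
lemma integral_sq_localDiscrepancy {P : Finset (ℝ × ℝ)}
    (h1 : ∀ p ∈ P, 0 ≤ p.1 ∧ p.1 ≤ 1) (h2 : ∀ p ∈ P, 0 ≤ p.2 ∧ p.2 ≤ 1) :
    ∫ β in (0 : ℝ)..1, ∫ α in (0 : ℝ)..1, localDiscrepancy α β P ^ 2 =
      ∑ p ∈ P, ∑ q ∈ P, (1 - max p.1 q.1) * (1 - max p.2 q.2) -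
        (P.card : ℝ) / 2 * ∑ p ∈ P, (1 - p.1 ^ 2) * (1 - p.2 ^ 2) + (P.card : ℝ) ^ 2 / 9 := by
  have hsq : ∀ α β, localDiscrepancy α β P ^ 2 =
      ∑ p ∈ P, ∑ q ∈ P, step (max p.2 q.2) β * step (max p.1 q.1) α -
        ∑ p ∈ P, (2 * P.card * β * step p.2 β) * (α * step p.1 α) +
        (P.card ^ 2 * β ^ 2) * α ^ 2 := by
    intro α β
    unfold localDiscrepancy
    rw [countBox_eq_sum (fun p hp => ⟨(h1 p hp).1, (h2 p hp).1⟩), sub_sq, sq (∑ p ∈ P, _),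
      Finset.sum_mul_sum, Finset.mul_sum, Finset.sum_mul]
    congr 1
    · congr 1
      · refine Finset.sum_congr rfl fun p _ => Finset.sum_congr rfl fun q _ => ?_
        rw [← step_mul_step, ← step_mul_step]; ring
      · refine Finset.sum_congr rfl fun p _ => ?_
        ring
    · ring
  simp_rw [hsq, integral_quadratic_step P _ _ _ h1]
  have := integral_quadratic_step P (fun p q => 1 - max p.1 q.1)
    (fun p => 2 * P.card * ((1 - p.1 ^ 2) / 2)) ((P.card : ℝ) ^ 2 / 3) h2
  calc _ = _ := by
        refine intervalIntegral.integral_congr fun β _ => ?_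
        exact congrArg₂ (· + ·) (congrArg₂ (· - ·)
          (Finset.sum_congr rfl fun p _ => Finset.sum_congr rfl fun q _ => mul_comm _ _)
          (Finset.sum_congr rfl fun p _ => by ring)) (by ring)
    _ = _ := this
    _ = _ := by
        rw [Finset.mul_sum]
        congr 1
        · congr 1
          refine Finset.sum_congr rfl fun p _ => ?_
          ring
        · ring

lemma lpDiscrepancy_two_eq (P : Finset (ℝ × ℝ)) :
    lpDiscrepancy 2 P = 1 / (P.card : ℝ) * Real.sqrt
      (∫ β in (0 : ℝ)..1, ∫ α in (0 : ℝ)..1, localDiscrepancy α β P ^ 2) := by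
  unfold lpDiscrepancy
  rw [Real.sqrt_eq_rpow]
  congr 4
  funext β
  congr 1
  funext α
  rw [Real.rpow_two, sq_abs]

/-! ### The points in centred coordinates -/

lemma zmod_two_val_eq (a : ZMod 2) : (a.val : ℝ) = (digitSign a + 1) / 2 := by
  unfold digitSign; ring

lemma sum_inv_two_pow (m : ℕ) :
    ∑ i : Fin m, (1 : ℝ) / 2 ^ ((i : ℕ) + 2) = (1 - 1 / 2 ^ m) / 2 := by
  induction m with
  | zero => simp
  | succ m ih =>
    rw [Fin.sum_univ_castSucc]
    simp only [Fin.val_castSucc, Fin.val_last, ih]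
    field_simp; ring

lemma sum_inv_two_pow_rev (m : ℕ) :
    ∑ i : Fin m, (1 : ℝ) / 2 ^ (m - (i : ℕ) + 1) = (1 - 1 / 2 ^ m) / 2 := by
  rw [← sum_inv_two_pow, ← Equiv.sum_comp Fin.revPerm]
  refine Finset.sum_congr rfl fun i _ => ?_
  have : m - (m - ((i : ℕ) + 1)) + 1 = (i : ℕ) + 2 := by omega
  rw [Fin.revPerm_apply, Fin.val_rev, this]

lemma point_eq {m : ℕ} (σ t : Fin m → ZMod 2) :
    point σ t = (centX t + (1 - 1 / 2 ^ m) / 2, centY σ t + (1 - 1 / 2 ^ m) / 2) := by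
  unfold point centX centY
  refine Prod.ext ?_ ?_
  · dsimp only
    rw [← sum_inv_two_pow_rev, ← Finset.sum_add_distrib]
    refine Finset.sum_congr rfl fun i _ => ?_
    rw [zmod_two_val_eq, pow_succ]; field_simp
  · dsimp only
    rw [← sum_inv_two_pow, ← Finset.sum_add_distrib]
    refine Finset.sum_congr rfl fun i _ => ?_
    rw [zmod_two_val_eq, pow_succ, pow_succ]; field_simp; ring

lemma abs_centY_le {m : ℕ} (σ t : Fin m → ZMod 2) : |centY σ t| ≤ (1 - 1 / 2 ^ m) / 2 := by
  rw [← sum_inv_two_pow, centY]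
  refine (Finset.abs_sum_le_sum_abs _ _).trans (Finset.sum_le_sum fun i _ => ?_)
  rw [abs_div, abs_digitSign, abs_of_pos (by positivity)]

lemma centX_injective (m : ℕ) : Function.Injective (centX : (Fin m → ZMod 2) → ℝ) := by
  intro t t' h
  by_contra hne
  have := le_abs_centX_sub hne
  rw [h, sub_self, abs_zero] at this
  exact absurd this (not_le.2 (by positivity))

lemma point_injective {m : ℕ} (σ : Fin m → ZMod 2) : Function.Injective (point σ) := by
  intro t t' h
  rw [point_eq, point_eq, Prod.mk.injEq] at h
  exact centX_injective m (add_right_cancel h.1)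

lemma centY_ne_zero {m : ℕ} (hm : 1 ≤ m) (σ t : Fin m → ZMod 2) : centY σ t ≠ 0 := by
  intro h
  have hne : t ≠ compl t := by
    intro he
    have := congrFun he ⟨0, hm⟩
    simp [compl] at this
  have := le_abs_centY_sub σ hne
  rw [centY_compl, h, neg_zero, sub_self, abs_zero] at this
  exact absurd this (not_le.2 (by positivity))

/-- A common point has the same t on both sides, since X determines t; then Y = -Y, but Y is nonzero
for m ≥ 1. -/
lemma disjoint_pointSet_compl {m : ℕ} (hm : 1 ≤ m) (σ : Fin m → ZMod 2) :
    Disjoint (pointSet σ) (pointSet (compl σ)) := by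
  rw [Finset.disjoint_left]
  intro p hp hp'
  unfold pointSet at hp hp'
  obtain ⟨t, -, rfl⟩ := Finset.mem_image.1 hp
  obtain ⟨t', -, h⟩ := Finset.mem_image.1 hp'
  rw [point_eq, point_eq, Prod.mk.injEq, centY_compl_shift] at h
  have ht := centX_injective m (add_right_cancel h.1)
  subst ht
  have := add_right_cancel h.2
  exact centY_ne_zero hm σ t' (by linarith)

lemma sum_symPointSet {m : ℕ} (hm : 1 ≤ m) (σ : Fin m → ZMod 2) (f : ℝ × ℝ → ℝ) :
    ∑ p ∈ symPointSet σ, f p = ∑ t, (f (point σ t) + f (point (compl σ) t)) := by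
  unfold symPointSet
  rw [Finset.sum_union (disjoint_pointSet_compl hm σ), pointSet, pointSet,
    Finset.sum_image (fun _ _ _ _ h => point_injective _ h),
    Finset.sum_image (fun _ _ _ _ h => point_injective _ h), Finset.sum_add_distrib]

lemma card_symPointSet {m : ℕ} (hm : 1 ≤ m) (σ : Fin m → ZMod 2) :
    (symPointSet σ).card = 2 ^ (m + 1) := by
  have h := sum_symPointSet hm σ (fun _ => 1)
  rw [sum_const_digits, Finset.sum_const, nsmul_eq_mul, mul_one] at h
  have h' : ((symPointSet σ).card : ℝ) = ((2 ^ (m + 1) : ℕ) : ℝ) := by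
    rw [h]; push_cast; ring
  exact_mod_cast h'

lemma point_mem_unit {m : ℕ} (σ t : Fin m → ZMod 2) :
    (0 ≤ (point σ t).1 ∧ (point σ t).1 ≤ 1) ∧ (0 ≤ (point σ t).2 ∧ (point σ t).2 ≤ 1) := by
  have h0 : (0 : ℝ) < 1 / 2 ^ m := by positivity
  have h1 := abs_le.1 (abs_centX_le t)
  have h2 := abs_le.1 (abs_centY_le σ t)
  rw [point_eq]
  refine ⟨⟨?_, ?_⟩, ?_, ?_⟩ <;> dsimp only <;> linarith [h1.1, h1.2, h2.1, h2.2]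

lemma mem_symPointSet_unit {m : ℕ} {σ : Fin m → ZMod 2} {p : ℝ × ℝ} (hp : p ∈ symPointSet σ) :
    (0 ≤ p.1 ∧ p.1 ≤ 1) ∧ (0 ≤ p.2 ∧ p.2 ≤ 1) := by
  unfold symPointSet pointSet at hp
  rcases Finset.mem_union.1 hp with h | h <;> obtain ⟨t, -, rfl⟩ := Finset.mem_image.1 h <;>
    exact point_mem_unit _ _

/-! ### Evaluation for the symmetrized set -/

lemma max_eq_half (x y : ℝ) : max x y = (x + y + |x - y|) / 2 := by
  rcases le_total x y with h | h
  · rw [max_eq_right h, abs_of_nonpos (by linarith)]; ring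
  · rw [max_eq_left h, abs_of_nonneg (by linarith)]; ring

lemma sum_eq_half_sum_add_compl {m : ℕ} (f : (Fin m → ZMod 2) → ℝ) :
    ∑ t, f t = ∑ t, (f t + f (compl t)) / 2 := by
  rw [← Finset.sum_div, Finset.sum_add_distrib, sum_compl]; ring

lemma sum_sum_eq_half_sum_add_compl {m : ℕ} (f : (Fin m → ZMod 2) → (Fin m → ZMod 2) → ℝ) :
    ∑ t, ∑ t', f t t' = ∑ t, ∑ t', (f t t' + f (compl t) (compl t')) / 2 := by
  have : ∑ t, ∑ t', f (compl t) (compl t') = ∑ t, ∑ t', f t t' := by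
    rw [← sum_compl (fun t => ∑ t', f t t')]
    exact Finset.sum_congr rfl fun t _ => sum_compl (f (compl t))
  simp only [← Finset.sum_div, Finset.sum_add_distrib]
  rw [this]; ring

/-- Adding the σ and σ* points removes the terms odd in Y; averaging over t and `compl t` removes
those odd in X. -/
lemma sum_one_sub_sq {m : ℕ} (hm : 1 ≤ m) (σ : Fin m → ZMod 2) :
    ∑ p ∈ symPointSet σ, (1 - p.1 ^ 2) * (1 - p.2 ^ 2) =
      2 * ∑ t : Fin m → ZMod 2, (1 - ((1 - 1 / 2 ^ m) / 2) ^ 2 - centX t ^ 2) *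
        (1 - ((1 - 1 / 2 ^ m) / 2) ^ 2 - centY σ t ^ 2) := by
  rw [sum_symPointSet hm, sum_eq_half_sum_add_compl, Finset.mul_sum]
  refine Finset.sum_congr rfl fun t _ => ?_
  simp only [point_eq, centY_compl_shift, centX_compl, centY_compl]
  ring

lemma sum_one_sub_max {m : ℕ} (hm : 1 ≤ m) (σ : Fin m → ZMod 2) :
    ∑ p ∈ symPointSet σ, ∑ q ∈ symPointSet σ, (1 - max p.1 q.1) * (1 - max p.2 q.2) =
      ∑ t : Fin m → ZMod 2, ∑ t' : Fin m → ZMod 2,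
        ((1 + 1 / 2 ^ m) / 2 - |centX t - centX t'| / 2) *
        (4 * ((1 + 1 / 2 ^ m) / 2) - |centY σ t - centY σ t'| - |centY σ t + centY σ t'|) := by
  rw [sum_symPointSet hm]
  calc _ = ∑ t : Fin m → ZMod 2, ∑ t' : Fin m → ZMod 2,
        ((1 + 1 / 2 ^ m) / 2 - (centX t + centX t') / 2 - |centX t - centX t'| / 2) *
        (4 * ((1 + 1 / 2 ^ m) / 2) - |centY σ t - centY σ t'| - |centY σ t + centY σ t'|) := by
        refine Finset.sum_congr rfl fun t _ => ?_
        rw [sum_symPointSet hm, sum_symPointSet hm, ← Finset.sum_add_distrib]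
        refine Finset.sum_congr rfl fun t' _ => ?_
        have e1 : |-centY σ t - centY σ t'| = |centY σ t + centY σ t'| := by
          rw [← abs_neg]; congr 1; ring
        have e2 : |-centY σ t + centY σ t'| = |centY σ t - centY σ t'| := by
          rw [← abs_neg]; congr 1; ring
        simp only [point_eq, centY_compl_shift, max_eq_half, add_sub_add_right_eq_sub, e1, e2,
          sub_neg_eq_add]
        ring
    _ = _ := by
        rw [sum_sum_eq_half_sum_add_compl]
        refine Finset.sum_congr rfl fun t _ => Finset.sum_congr rfl fun t' _ => ?_
        have e1 : |-centX t - -centX t'| = |centX t - centX t'| := by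
          rw [← abs_neg]; congr 1; ring
        have e2 : |-centY σ t - -centY σ t'| = |centY σ t - centY σ t'| := by
          rw [← abs_neg]; congr 1; ring
        have e3 : |-centY σ t + -centY σ t'| = |centY σ t + centY σ t'| := by
          rw [← abs_neg]; congr 1; ring
        simp only [centX_compl, centY_compl, e1, e2, e3]
        ring

lemma sum_abs_centY_add {m : ℕ} (σ : Fin m → ZMod 2) :
    ∑ t : Fin m → ZMod 2, ∑ t' : Fin m → ZMod 2, |centY σ t + centY σ t'| =
      ((2 ^ m) ^ 2 - 1) / 3 := by
  rw [← sum_abs_centY_sub σ]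
  refine Finset.sum_congr rfl fun t _ => ?_
  rw [← sum_compl (fun t' => |centY σ t - centY σ t'|)]
  simp only [centY_compl, sub_neg_eq_add]

lemma integral_sq_localDiscrepancy_symPointSet {m : ℕ} (hm : 1 ≤ m) (σ : Fin m → ZMod 2) :
    ∫ β in (0 : ℝ)..1, ∫ α in (0 : ℝ)..1, localDiscrepancy α β (symPointSet σ) ^ 2 =
      (m : ℝ) / 24 + 11 / 8 + 1 / 2 ^ m - 1 / (9 * 2 ^ (2 * m + 1)) := by
  rw [integral_sq_localDiscrepancy (fun p hp => (mem_symPointSet_unit hp).1)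
    (fun p hp => (mem_symPointSet_unit hp).2), sum_one_sub_max hm, sum_one_sub_sq hm,
    card_symPointSet hm]
  -- Applied with q = 1 - c; below, `hS2` is applied with k = 1 - c^2.
  have hS1 : ∀ q : ℝ, ∑ t : Fin m → ZMod 2, ∑ t' : Fin m → ZMod 2,
      (q - |centX t - centX t'| / 2) *
        (4 * q - |centY σ t - centY σ t'| - |centY σ t + centY σ t'|) =
      4 * q ^ 2 * (2 ^ m) ^ 2 - 4 * q * (((2 ^ m) ^ 2 - 1) / 3) +
        (∑ t, ∑ t', |centX t - centX t'| * |centY σ t - centY σ t'| +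
          ∑ t, ∑ t', |centX t - centX t'| * |centY σ t + centY σ t'|) / 2 := by
    intro q
    calc _ = ∑ t : Fin m → ZMod 2, ∑ t' : Fin m → ZMod 2,
          (4 * q ^ 2 + |centX t - centX t'| * (-2 * q) + |centY σ t - centY σ t'| * (-q) +
            |centY σ t + centY σ t'| * (-q) +
            |centX t - centX t'| * |centY σ t - centY σ t'| * (1 / 2) +
            |centX t - centX t'| * |centY σ t + centY σ t'| * (1 / 2)) := by
          refine Finset.sum_congr rfl fun t _ => Finset.sum_congr rfl fun t' _ => ?_
          ring
      _ = _ := by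
          simp only [Finset.sum_add_distrib, ← Finset.sum_mul, sum_const_digits]
          rw [sum_abs_centX_sub, sum_abs_centY_sub, sum_abs_centY_add]
          ring
  have hS2 : ∀ k : ℝ, ∑ t : Fin m → ZMod 2, (k - centX t ^ 2) * (k - centY σ t ^ 2) =
      k ^ 2 * 2 ^ m - 2 * k * ((2 ^ m - 1 / 2 ^ m) / 12) +
        ∑ t, centX t ^ 2 * centY σ t ^ 2 := by
    intro k
    calc _ = ∑ t : Fin m → ZMod 2, (k ^ 2 + centX t ^ 2 * (-k) + centY σ t ^ 2 * (-k) +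
            centX t ^ 2 * centY σ t ^ 2) := by
          refine Finset.sum_congr rfl fun t _ => ?_
          ring
      _ = _ := by
          simp only [Finset.sum_add_distrib, ← Finset.sum_mul, sum_const_digits]
          rw [sum_centX_sq, sum_centY_sq]; ring
  rw [hS1, hS2, sum_abs_centX_sub_mul_abs_centY_sub, sum_centX_sq_mul_centY_sq]
  obtain ⟨n, rfl⟩ : ∃ n, m = n + 1 := ⟨m - 1, by omega⟩
  rw [sum_abs_centX_sub_mul_abs_centY_add]
  have hM : (2 : ℝ) ^ n ≠ 0 := by positivity
  have hp : (2 : ℝ) ^ (2 * (n + 1) + 1) = (2 ^ n) ^ 2 * 8 := by ring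
  rw [hp]
  push_cast
  field_simp
  ring

end Hammersley

theorem theorem1 (m : ℕ) (hm : 1 ≤ m) (σ : Fin m → ZMod 2) :
    (Hammersley.symPointSet σ).card = 2 ^ (m + 1) ∧
    ((2 : ℝ) ^ (m + 1) * Hammersley.lpDiscrepancy 2 (Hammersley.symPointSet σ)) ^ 2 =
      (m : ℝ) / 24 + 11 / 8 + 1 / 2 ^ m - 1 / (9 * 2 ^ (2 * m + 1)) ∧
    (∀ N : ℝ, N = 2 ^ (m + 1) →
      Hammersley.lpDiscrepancy 2 (Hammersley.symPointSet σ) =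
        1 / N * Real.sqrt
          (Real.log N / (24 * Real.log 2) + 4 / 3 + 2 / N - 2 / (9 * N ^ 2))) ∧
    (∀ τ : Fin m → ZMod 2,
      Hammersley.lpDiscrepancy 2 (Hammersley.symPointSet σ) =
        Hammersley.lpDiscrepancy 2 (Hammersley.symPointSet τ)) := by
  have hL : ∀ τ : Fin m → ZMod 2, Hammersley.lpDiscrepancy 2 (Hammersley.symPointSet τ) =
      1 / 2 ^ (m + 1) * Real.sqrt
        ((m : ℝ) / 24 + 11 / 8 + 1 / 2 ^ m - 1 / (9 * 2 ^ (2 * m + 1))) := by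
    intro τ
    rw [Hammersley.lpDiscrepancy_two_eq, Hammersley.integral_sq_localDiscrepancy_symPointSet hm,
      Hammersley.card_symPointSet hm]
    push_cast
    rfl
  have hpow : (0 : ℝ) < 2 ^ (m + 1) := by positivity
  refine ⟨Hammersley.card_symPointSet hm σ, ?_, ?_, fun τ => by rw [hL, hL]⟩
  · rw [hL, ← mul_assoc, mul_one_div_cancel hpow.ne', one_mul, Real.sq_sqrt]
    have h1 : (1 : ℝ) / (9 * 2 ^ (2 * m + 1)) ≤ 1 := by
      rw [div_le_one (by positivity)]
      have : (1 : ℝ) ≤ 2 ^ (2 * m + 1) := one_le_pow₀ (by norm_num)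
      linarith
    have h2 : (0 : ℝ) < 1 / 2 ^ m := by positivity
    have h3 : (0 : ℝ) ≤ (m : ℝ) / 24 := by positivity
    linarith
  · rintro N rfl
    rw [hL]
    congr 2
    have hlog : Real.log 2 ≠ 0 := (Real.log_pos (by norm_num)).ne'
    have hM : (2 : ℝ) ^ m ≠ 0 := by positivity
    have hp : (2 : ℝ) ^ (2 * m + 1) = (2 ^ m) ^ 2 * 2 := by ring
    -- As log N = (m + 1) log 2, the constants match through 11/8 = 1/24 + 4/3.
    rw [Real.log_pow, hp, pow_succ]
    push_cast
    field_simp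
    ring
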